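/- Let $F:\mathbb{R}\to\mathbb{R}$ be locally Lipschitz with $F(p)=p$ for $p\in[0,1]$ and $F(p)\le p$ for $p\in[-1,0]$, and let $g(x)=\max\{1-|x|,0\}$ for $x\in\mathbb{R}$. Then, for every $\varepsilon\in(0,\tfrac14)$, \[ |u^\varepsilon(0,1)-u(0,1)|\;\ge\;\frac{\mathrm e-1}{\sqrt{\pi}\,\mathrm e}\,\sqrt{\varepsilon}, \] where $u^\varepsilon$ is the viscosity solution of \[ u^\varepsilon_t+F(u^\varepsilon_x)=\varepsilon u^\varepsilon_{xx}\ \text{ in }\mathbb{R}\times(0,\infty),\qquad u^\varepsilon(x,0)=g(x)\ \text{ on }\mathbb{R}, \] and $u$ is the viscosity solution of \[ u_t+F(u_x)=0\ \text{ in }\mathbb{R}\times(0,\infty),\qquad u(x,0)=g(x)\ \text{ on }\mathbb{R}. \] Here viscosity solutions are functions in $C(\mathbb{R}\times[0,\infty))$ that are bounded on $\mathbb{R}\times[0,T]$ for every $T>0$ and take the initial datum pointwise. A function $w$ is a viscosity solution of $w_t+F(w_x)=\nu w_{xx}$ ($\nu\ge 0$) if for every $\varphi\in C^2(\mathbb{R}\times(0,\infty))$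 and every $(x_0,t_0)\in\mathbb{R}\times(0,\infty)$ one has, at $(x_0,t_0)$, $\varphi_t+F(\varphi_x)\le\nu\varphi_{xx}$ whenever $w-\varphi$ has a local maximum there, and $\varphi_t+F(\varphi_x)\ge\nu\varphi_{xx}$ whenever $w-\varphi$ has a local minimum there. -/

import Mathlib

/-- `u` satisfies `u_t + F(u_x) ≤ ν u_xx` on `ℝ × (0, ∞)` in the viscosity sense. Points of
space-time are pairs `(x, t)`; test functions are `C²` on `ℝ × (0, ∞)`. For `ν = 0` this is the
first-order inequality `u_t + F(u_x) ≤ 0`. -/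
def IsViscositySubsolution (F : ℝ → ℝ) (ν : ℝ) (u : ℝ × ℝ → ℝ) : Prop :=
  ∀ φ : ℝ × ℝ → ℝ, ContDiffOn ℝ 2 φ (Set.univ ×ˢ Set.Ioi 0) →
    ∀ x t : ℝ, 0 < t → IsLocalMax (fun z => u z - φ z) (x, t) →
      deriv (fun s => φ (x, s)) t + F (deriv (fun y => φ (y, t)) x)
        ≤ ν * iteratedDeriv 2 (fun y => φ (y, t)) x

/-- `u` satisfies `u_t + F(u_x) ≥ ν u_xx` on `ℝ × (0, ∞)` in the viscosity sense. -/
def IsViscositySupersolution (F : ℝ → ℝ) (ν : ℝ) (u : ℝ × ℝ → ℝ) : Prop :=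
  ∀ φ : ℝ × ℝ → ℝ, ContDiffOn ℝ 2 φ (Set.univ ×ˢ Set.Ioi 0) →
    ∀ x t : ℝ, 0 < t → IsLocalMin (fun z => u z - φ z) (x, t) →
      ν * iteratedDeriv 2 (fun y => φ (y, t)) x
        ≤ deriv (fun s => φ (x, s)) t + F (deriv (fun y => φ (y, t)) x)

/-- `u ∈ C(ℝ × [0, ∞))` is a viscosity solution of the Cauchy problem
`u_t + F(u_x) = ν u_xx` in `ℝ × (0, ∞)`, `u(·, 0) = g`, in the class of functions that are bounded
on `ℝ × [0, T]` for every `T`, the uniqueness class for a bounded Lipschitz datum `g`.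
The values of `u` at negative times play no role. -/
structure IsViscositySolution (F : ℝ → ℝ) (ν : ℝ) (g : ℝ → ℝ) (u : ℝ × ℝ → ℝ) : Prop where
  continuousOn : ContinuousOn u (Set.univ ×ˢ Set.Ici 0)
  bounded : ∀ T : ℝ, ∃ C : ℝ, ∀ x : ℝ, ∀ t ∈ Set.Icc 0 T, |u (x, t)| ≤ C
  initial : ∀ x : ℝ, u (x, 0) = g x
  subsolution : IsViscositySubsolution F ν u
  supersolution : IsViscositySupersolution F ν u

/-! The two solutions are separated by explicit barriers. The tent has slopes in `[-1, 1]`, and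
there `F p ≤ p`. So the solution of the linear equation `w_t + w_x = ε w_xx` with tent datum, whose
slopes stay in `[-1, 1]`, is a subsolution of the viscous problem and lies below `uε`. It is the
heat flow of the tent carried at unit speed; at `(0, 1)` the foot `-1` of the tent has just arrived,
and diffusion has lifted the value there to order `√ε`.

For the first-order problem, `max (x - t + 1) 0` travels with slopes in `[0, 1]`, where `F p = p`.
Smoothed, it is an exact solution above the datum, so `u (0, 1) ≤ 0`.

Both barriers are smooth, so a comparison principle against smooth functions suffices
(`IsViscositySupersolution.le_of_smooth_subsolution`), with no doubling of variables. The constant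
comes from `normalRamp_tent_lower`. -/

/-! ### Comparison with smooth subsolutions -/

/-- The negative of a viscosity subsolution is a supersolution for the reflected Hamiltonian. -/
lemma IsViscositySubsolution.neg {F : ℝ → ℝ} {ν : ℝ} {u : ℝ × ℝ → ℝ}
    (hu : IsViscositySubsolution F ν u) :
    IsViscositySupersolution (fun p => -F (-p)) ν (fun z => -u z) := by
  intro φ hφ x t ht hmin
  have hmax : IsLocalMax (fun z => u z - (-φ z)) (x, t) := by
    filter_upwards [hmin] with z hz
    linarith
  have h := hu (fun z => -φ z) hφ.neg x t ht hmax
  have e : iteratedDeriv 2 (fun y => -φ (y, t)) x = -iteratedDeriv 2 (fun y => φ (y, t)) x :=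
    iteratedDeriv_fun_neg 2 _ x
  simp only [deriv.fun_neg, e] at h
  linarith

lemma hasDerivAt_sqrt_one_add_sq (x : ℝ) :
    HasDerivAt (fun y : ℝ => √(1 + y ^ 2)) (x / √(1 + x ^ 2)) x := by
  have h := ((hasDerivAt_pow 2 x).const_add 1).sqrt (by positivity)
  convert h using 1
  field_simp
  norm_num
  ring

lemma hasDerivAt_div_sqrt_one_add_sq (x : ℝ) :
    HasDerivAt (fun y : ℝ => y / √(1 + y ^ 2)) (1 / (√(1 + x ^ 2)) ^ 3) x := by
  have hs : √(1 + x ^ 2) ≠ 0 := by positivity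
  have h := (hasDerivAt_id x).div (hasDerivAt_sqrt_one_add_sq x) hs
  have h2 : √(1 + x ^ 2) ^ 2 = 1 + x ^ 2 := Real.sq_sqrt (by positivity)
  refine h.congr_deriv ?_
  rw [id, div_eq_div_iff (by positivity) (by positivity)]
  field_simp
  linarith

/-- A continuous function on the closed strip `ℝ × [0, T]` that takes a negative value inside but is
nonnegative for large `|x|` and at the times `0` and `T` has an interior negative local minimum. -/
lemma exists_isLocalMin_of_strip {h : ℝ × ℝ → ℝ} {T R : ℝ}
    (hc : ContinuousOn h (Set.univ ×ˢ Set.Icc 0 T))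
    (hR : ∀ x t, t ∈ Set.Icc 0 T → R ≤ |x| → 0 ≤ h (x, t))
    (h0 : ∀ x, 0 ≤ h (x, 0)) (hT : ∀ x, 0 ≤ h (x, T))
    {x₀ t₀ : ℝ} (ht₀ : t₀ ∈ Set.Icc 0 T) (hneg : h (x₀, t₀) < 0) :
    ∃ x t, 0 < t ∧ t < T ∧ IsLocalMin h (x, t) := by
  have hmem : ∀ x t, t ∈ Set.Icc 0 T → h (x, t) < 0 →
      x ∈ Set.Ioo (-R) R ∧ t ∈ Set.Ioo 0 T := by
    intro x t ht hxt
    refine ⟨abs_lt.mp ?_, lt_of_le_of_ne ht.1 ?_, lt_of_le_of_ne ht.2 ?_⟩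
    · by_contra! hx
      exact absurd (hR x t ht hx) (not_le.mpr hxt)
    · rintro rfl
      exact absurd (h0 x) (not_le.mpr hxt)
    · rintro rfl
      exact absurd (hT x) (not_le.mpr hxt)
  have hK : IsCompact (Set.Icc (-R) R ×ˢ Set.Icc 0 T) := isCompact_Icc.prod isCompact_Icc
  have hz₀ := hmem x₀ t₀ ht₀ hneg
  obtain ⟨⟨x, t⟩, hz, hmin⟩ := hK.exists_isMinOn
    ⟨(x₀, t₀), Set.Ioo_subset_Icc_self hz₀.1, ht₀⟩
    (hc.mono (Set.prod_mono (Set.subset_univ _) le_rfl))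
  have hle : h (x, t) ≤ h (x₀, t₀) := hmin ⟨Set.Ioo_subset_Icc_self hz₀.1, ht₀⟩
  have hi := hmem x t hz.2 (hle.trans_lt hneg)
  refine ⟨x, t, hi.2.1, hi.2.2, hmin.isLocalMin ?_⟩
  exact prod_mem_nhds (Icc_mem_nhds hi.1.1 hi.1.2) (Icc_mem_nhds hi.2.1 hi.2.2)

/-- Comparison of a viscosity supersolution with a smooth subsolution of slope at most one. -/
theorem IsViscositySupersolution.le_of_smooth_subsolution {F : ℝ → ℝ} (hF : LocallyLipschitz F)
    {ν : ℝ} (hν : 0 ≤ ν) {u v : ℝ × ℝ → ℝ} (hu : IsViscositySupersolution F ν u)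
    (huc : ContinuousOn u (Set.univ ×ˢ Set.Ici 0))
    (hub : ∀ T : ℝ, ∃ C : ℝ, ∀ x : ℝ, ∀ t ∈ Set.Icc 0 T, |u (x, t)| ≤ C)
    (hvc : ContinuousOn v (Set.univ ×ˢ Set.Ici 0))
    (hv2 : ContDiffOn ℝ 2 v (Set.univ ×ˢ Set.Ioi 0))
    (hvb : ∀ T : ℝ, ∃ C : ℝ, ∀ x : ℝ, ∀ t ∈ Set.Icc 0 T, v (x, t) ≤ C)
    {vt vx vxx : ℝ → ℝ → ℝ}
    (hvt : ∀ x t, 0 < t → HasDerivAt (fun s => v (x, s)) (vt x t) t)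
    (hvx : ∀ x t, 0 < t → HasDerivAt (fun y => v (y, t)) (vx x t) x)
    (hvxx : ∀ x t, 0 < t → HasDerivAt (fun y => vx y t) (vxx x t) x)
    (hslope : ∀ x t, 0 < t → |vx x t| ≤ 1)
    (hsub : ∀ x t, 0 < t → vt x t + F (vx x t) ≤ ν * vxx x t)
    (h0 : ∀ x, v (x, 0) ≤ u (x, 0)) {x₀ t₀ : ℝ} (ht₀ : 0 < t₀) :
    v (x₀, t₀) ≤ u (x₀, t₀) := by
  -- Slopes of `v` lie in `[-1, 1]` and the penalty below shifts them by at most `δ ≤ 1`.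
  obtain ⟨L, hL⟩ := LocallyLipschitzOn.exists_lipschitzOnWith_of_compact
    (isCompact_Icc (a := (-2 : ℝ)) (b := 2)) (hF.locallyLipschitzOn)
  -- `L` and `ν` absorb the first- and second-order errors of the penalty; the extra `1` makes the
  -- inequality strict.
  set K : ℝ := L + ν + 1 with hK
  have hKpos : 0 < K := by positivity
  suffices key : ∀ δ, 0 < δ → δ ≤ 1 →
      v (x₀, t₀) - δ * (√(1 + x₀ ^ 2) + K * t₀ + 1) ≤ u (x₀, t₀) by
    have hlim : Filter.Tendsto (fun δ : ℝ => v (x₀, t₀) - δ * (√(1 + x₀ ^ 2) + K * t₀ + 1))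
        (nhdsWithin 0 (Set.Ioi 0)) (nhds (v (x₀, t₀))) := by
      have : Continuous (fun δ : ℝ => v (x₀, t₀) - δ * (√(1 + x₀ ^ 2) + K * t₀ + 1)) := by
        fun_prop
      simpa using (this.tendsto 0).mono_left nhdsWithin_le_nhds
    refine le_of_tendsto hlim ?_
    filter_upwards [Ioc_mem_nhdsGT (zero_lt_one' ℝ)] with δ hδ using key δ hδ.1 hδ.2
  intro δ hδ hδ1
  by_contra! hlt
  obtain ⟨C, hC⟩ := hub (2 * t₀)
  obtain ⟨M, hM⟩ := hvb (2 * t₀)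
  -- With this `n` the exponential penalty, equal to `1` at `t₀`, exceeds the bound on `v - u` at
  -- time `2 * t₀`. The minimum is then interior in time as well as in space.
  obtain ⟨n, hn⟩ := exists_nat_gt ((C + M) / (δ * t₀))
  have hn' : C + M ≤ δ * (n * t₀) := by
    rw [div_lt_iff₀ (by positivity)] at hn
    linarith
  let ψ : ℝ × ℝ → ℝ := fun z => v z - δ * (√(1 + z.1 ^ 2) + K * z.2 + Real.exp (n * (z.2 - t₀)))
  have hpen : ∀ x : ℝ, 0 ≤ √(1 + x ^ 2) := fun x => Real.sqrt_nonneg _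
  have hpsmooth : ContDiff ℝ 2
      (fun z : ℝ × ℝ => δ * (√(1 + z.1 ^ 2) + K * z.2 + Real.exp (n * (z.2 - t₀)))) := by
    refine contDiff_const.mul ((ContDiff.add (ContDiff.sqrt (by fun_prop) ?_)
      (by fun_prop)).add (by fun_prop))
    intro z
    positivity
  have hlow : ∀ x t, t ∈ Set.Icc 0 (2 * t₀) → -C - M ≤ u (x, t) - v (x, t) := by
    intro x t ht
    have := (abs_le.mp (hC x t ht)).1
    have := hM x t ht
    linarith
  obtain ⟨x, t, ht, -, hmin⟩ := exists_isLocalMin_of_strip (h := fun z => u z - ψ z)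
    (T := 2 * t₀) (R := (C + M) / δ) (x₀ := x₀) (t₀ := t₀)
    (by
      have hss : (Set.univ ×ˢ Set.Icc 0 (2 * t₀) : Set (ℝ × ℝ)) ⊆ Set.univ ×ˢ Set.Ici 0 :=
        Set.prod_mono le_rfl Set.Icc_subset_Ici_self
      exact (huc.mono hss).sub ((hvc.mono hss).sub hpsmooth.continuous.continuousOn))
    (by
      intro x t ht hx
      have h1 := hlow x t ht
      have h2 : |x| ≤ √(1 + x ^ 2) := Real.abs_le_sqrt (by linarith)
      have h3 : (C + M) ≤ δ * √(1 + x ^ 2) := by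
        rw [div_le_iff₀ hδ] at hx
        nlinarith
      have h4 : 0 ≤ δ * (K * t + Real.exp (n * (t - t₀))) :=
        mul_nonneg hδ.le (add_nonneg (mul_nonneg hKpos.le ht.1) (Real.exp_pos _).le)
      simp only [ψ]
      linarith)
    (by
      intro x
      have h1 := h0 x
      have h2 : 0 ≤ δ * (√(1 + x ^ 2) + K * 0 + Real.exp (n * (0 - t₀))) := by positivity
      simp only [ψ]
      linarith)
    (by
      intro x
      have h1 := hlow x (2 * t₀) ⟨by positivity, le_rfl⟩
      have h2 : 0 ≤ δ * (√(1 + x ^ 2) + K * (2 * t₀)) := by positivity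
      have h3 : n * t₀ ≤ Real.exp (n * (2 * t₀ - t₀)) := by
        have := Real.add_one_le_exp (n * (2 * t₀ - t₀))
        linarith
      have h4 := mul_le_mul_of_nonneg_left h3 hδ.le
      simp only [ψ]
      linarith)
    ⟨ht₀.le, by linarith⟩
    (by
      simp only [ψ, sub_self, mul_zero, Real.exp_zero]
      linarith)
  have hψ : ContDiffOn ℝ 2 ψ (Set.univ ×ˢ Set.Ioi 0) := hv2.sub hpsmooth.contDiffOn
  have hmain := hu ψ hψ x t ht hmin
  have dt : HasDerivAt (fun s => ψ (x, s))
      (vt x t - δ * (K + Real.exp (n * (t - t₀)) * n)) t := by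
    have e1 : HasDerivAt (fun s : ℝ => √(1 + x ^ 2) + K * s) K t := by
      simpa using ((hasDerivAt_id t).const_mul K).const_add (√(1 + x ^ 2))
    have e2 : HasDerivAt (fun s : ℝ => Real.exp (n * (s - t₀)))
        (Real.exp (n * (t - t₀)) * n) t := by
      simpa using (((hasDerivAt_id t).sub_const t₀).const_mul (n : ℝ)).exp
    exact (hvt x t ht).sub ((e1.add e2).const_mul δ)
  have dx : ∀ y, HasDerivAt (fun y => ψ (y, t)) (vx y t - δ * (y / √(1 + y ^ 2))) y := by
    intro y
    exact (hvx y t ht).sub ((((hasDerivAt_sqrt_one_add_sq y).add_const (K * t)).add_const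
      (Real.exp (n * (t - t₀)))).const_mul δ)
  have dxx : HasDerivAt (fun y => vx y t - δ * (y / √(1 + y ^ 2)))
      (vxx x t - δ * (1 / (√(1 + x ^ 2)) ^ 3)) x :=
    (hvxx x t ht).sub ((hasDerivAt_div_sqrt_one_add_sq x).const_mul δ)
  have e2 : iteratedDeriv 2 (fun y => ψ (y, t)) x = vxx x t - δ * (1 / (√(1 + x ^ 2)) ^ 3) := by
    rw [iteratedDeriv_succ, iteratedDeriv_one, funext fun y => (dx y).deriv, dxx.deriv]
  rw [dt.deriv, (dx x).deriv, e2] at hmain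
  have hs1 : 1 ≤ √(1 + x ^ 2) := Real.one_le_sqrt.mpr (by nlinarith)
  have hq : |x / √(1 + x ^ 2)| ≤ 1 := by
    rw [abs_div, abs_of_pos (by positivity : 0 < √(1 + x ^ 2)), div_le_one (by positivity)]
    exact Real.abs_le_sqrt (by linarith)
  have hcub : 1 / (√(1 + x ^ 2)) ^ 3 ≤ 1 := by
    rw [div_le_one (by positivity)]
    exact one_le_pow₀ hs1
  have hp := abs_le.mp (hslope x t ht)
  have hdq : |δ * (x / √(1 + x ^ 2))| ≤ δ := by
    rw [abs_mul, abs_of_pos hδ]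
    nlinarith
  have hdq' := abs_le.mp hdq
  have hLip := hL.dist_le_mul (vx x t - δ * (x / √(1 + x ^ 2)))
    ⟨by linarith, by linarith⟩ (vx x t) ⟨by linarith, by linarith⟩
  rw [Real.dist_eq, Real.dist_eq, sub_sub_cancel_left, abs_neg] at hLip
  have hF1 : F (vx x t - δ * (x / √(1 + x ^ 2))) - F (vx x t) ≤ L * δ :=
    (le_abs_self _).trans (hLip.trans (mul_le_mul_of_nonneg_left hdq L.2))
  have hexp : 0 ≤ δ * (Real.exp (n * (t - t₀)) * n) := by positivity
  have hνδ : ν * (δ * (1 / (√(1 + x ^ 2)) ^ 3)) ≤ ν * δ :=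
    mul_le_mul_of_nonneg_left (by nlinarith) hν
  have hs := hsub x t ht
  have hKδ : δ * K = L * δ + ν * δ + δ := by rw [hK]; ring
  nlinarith

/-! ### The Gaussian ramp -/

open ProbabilityTheory in
/-- The standard normal density. -/
noncomputable def normalDensity : ℝ → ℝ := gaussianPDFReal 0 1

lemma normalDensity_eq (x : ℝ) :
    normalDensity x = (√(2 * Real.pi))⁻¹ * Real.exp (-(x ^ 2) / 2) := by
  simp [normalDensity, ProbabilityTheory.gaussianPDFReal]

lemma normalDensity_nonneg (x : ℝ) : 0 ≤ normalDensity x :=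
  ProbabilityTheory.gaussianPDFReal_nonneg 0 1 x

lemma integrable_normalDensity : MeasureTheory.Integrable normalDensity :=
  ProbabilityTheory.integrable_gaussianPDFReal 0 1

lemma integral_normalDensity : ∫ x, normalDensity x = 1 :=
  ProbabilityTheory.integral_gaussianPDFReal_eq_one 0 one_ne_zero

lemma contDiff_normalDensity {n : WithTop ℕ∞} : ContDiff ℝ n normalDensity := by
  rw [funext normalDensity_eq]
  fun_prop

lemma hasDerivAt_normalDensity (x : ℝ) :
    HasDerivAt normalDensity (-(x * normalDensity x)) x := by
  rw [funext normalDensity_eq]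
  have h := (((hasDerivAt_pow 2 x).neg.div_const 2).exp).const_mul (√(2 * Real.pi))⁻¹
  refine h.congr_deriv ?_
  norm_num
  ring

lemma normalDensity_le_zero (x : ℝ) : normalDensity x ≤ normalDensity 0 := by
  rw [normalDensity_eq, normalDensity_eq]
  exact mul_le_mul_of_nonneg_left (Real.exp_le_exp.mpr (by nlinarith [sq_nonneg x]))
    (by positivity)

lemma normalDensity_neg (x : ℝ) : normalDensity (-x) = normalDensity x := by
  simp [normalDensity_eq]

lemma integrable_mul_normalDensity :
    MeasureTheory.Integrable (fun x => x * normalDensity x) := by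
  have h := (integrable_mul_exp_neg_mul_sq (b := 1 / 2) (by norm_num)).const_mul
    (√(2 * Real.pi))⁻¹
  refine h.congr (Filter.Eventually.of_forall fun x => ?_)
  simp only [normalDensity_eq]
  ring_nf

lemma integral_mul_normalDensity : ∫ x, x * normalDensity x = 0 := by
  have h := MeasureTheory.integral_neg_eq_self (fun x => x * normalDensity x) MeasureTheory.volume
  simp only [normalDensity_neg, neg_mul, MeasureTheory.integral_neg] at h
  linarith

/-- The standard normal distribution function. -/
noncomputable def normalCDF (z : ℝ) : ℝ := ∫ x in Set.Iic z, normalDensity x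

lemma normalCDF_mono : Monotone normalCDF := fun _ _ h =>
  MeasureTheory.setIntegral_mono_set integrable_normalDensity.integrableOn
    (Filter.Eventually.of_forall normalDensity_nonneg) (Set.Iic_subset_Iic.mpr h).eventuallyLE

lemma normalCDF_nonneg (z : ℝ) : 0 ≤ normalCDF z :=
  MeasureTheory.integral_nonneg normalDensity_nonneg

lemma normalCDF_le_one (z : ℝ) : normalCDF z ≤ 1 :=
  (MeasureTheory.setIntegral_le_integral integrable_normalDensity
    (Filter.Eventually.of_forall normalDensity_nonneg)).trans integral_normalDensity.le

lemma hasDerivAt_normalCDF (z : ℝ) : HasDerivAt normalCDF (normalDensity z) z := by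
  have hc : Continuous normalDensity := (contDiff_normalDensity (n := 0)).continuous
  have e : normalCDF = fun y => normalCDF 0 + ∫ x in (0 : ℝ)..y, normalDensity x := by
    funext y
    rw [← intervalIntegral.integral_Iic_sub_Iic integrable_normalDensity.integrableOn
      integrable_normalDensity.integrableOn]
    simp [normalCDF]
  rw [e]
  exact (hc.integral_hasStrictDerivAt 0 z).hasDerivAt.const_add _

/-- The expectation of the positive part of `z + Z` for a standard normal variable `Z`. -/
noncomputable def normalRamp (z : ℝ) : ℝ := z * normalCDF z + normalDensity z

lemma hasDerivAt_normalRamp (z : ℝ) : HasDerivAt normalRamp (normalCDF z) z := by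
  have h := ((hasDerivAt_id z).mul (hasDerivAt_normalCDF z)).add (hasDerivAt_normalDensity z)
  refine h.congr_deriv ?_
  simp

lemma contDiff_normalRamp : ContDiff ℝ 2 normalRamp := by
  have h1 : ContDiff ℝ 1 normalCDF := contDiff_one_iff_deriv.mpr
    ⟨fun z => (hasDerivAt_normalCDF z).differentiableAt, by
      rw [funext fun z => (hasDerivAt_normalCDF z).deriv]
      exact (contDiff_normalDensity (n := 0)).continuous⟩
  rw [show (2 : WithTop ℕ∞) = 1 + 1 from one_add_one_eq_two.symm, contDiff_succ_iff_deriv]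
  refine ⟨fun z => (hasDerivAt_normalRamp z).differentiableAt, by simp, ?_⟩
  rwa [funext fun z => (hasDerivAt_normalRamp z).deriv]

lemma normalRamp_eq_integral (z : ℝ) :
    normalRamp z = ∫ x in Set.Iic z, (z - x) * normalDensity x := by
  have hlim : Filter.Tendsto normalDensity Filter.atBot (nhds 0) :=
    MeasureTheory.tendsto_zero_of_hasDerivAt_of_integrableOn_Iic (a := 0)
      (fun x _ => hasDerivAt_normalDensity x) integrable_mul_normalDensity.neg.integrableOn
      integrable_normalDensity.integrableOn
  have h := MeasureTheory.integral_Iic_of_hasDerivAt_of_tendsto' (a := z)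
    (fun x _ => hasDerivAt_normalDensity x) integrable_mul_normalDensity.neg.integrableOn hlim
  rw [MeasureTheory.integral_neg] at h
  simp only [sub_mul]
  rw [MeasureTheory.integral_sub (integrable_normalDensity.const_mul z).integrableOn
    integrable_mul_normalDensity.integrableOn, MeasureTheory.integral_const_mul]
  simp only [normalRamp, normalCDF]
  linarith

lemma normalRamp_nonneg (z : ℝ) : 0 ≤ normalRamp z := by
  rw [normalRamp_eq_integral]
  exact MeasureTheory.setIntegral_nonneg measurableSet_Iic fun x hx =>
    mul_nonneg (sub_nonneg.mpr hx) (normalDensity_nonneg x)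

/-- Averaging `z - x` over the whole line gives `z`, and discarding `x > z`, where the integrand is
nonpositive, can only increase the integral. -/
lemma self_le_normalRamp (z : ℝ) : z ≤ normalRamp z := by
  have hint : MeasureTheory.Integrable (fun x => (z - x) * normalDensity x) := by
    simp only [sub_mul]
    exact (integrable_normalDensity.const_mul z).sub integrable_mul_normalDensity
  have htot : ∫ x, (z - x) * normalDensity x = z := by
    simp only [sub_mul]
    rw [MeasureTheory.integral_sub (integrable_normalDensity.const_mul z)
      integrable_mul_normalDensity, MeasureTheory.integral_const_mul, integral_normalDensity,
      integral_mul_normalDensity]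
    ring
  have hsplit := intervalIntegral.integral_Iic_add_Ioi (b := z) hint.integrableOn
    hint.integrableOn
  have hneg : ∫ x in Set.Ioi z, (z - x) * normalDensity x ≤ 0 :=
    MeasureTheory.setIntegral_nonpos measurableSet_Ioi fun x hx =>
      mul_nonpos_of_nonpos_of_nonneg (sub_nonpos.mpr (le_of_lt hx)) (normalDensity_nonneg x)
  rw [normalRamp_eq_integral]
  linarith

lemma normalRamp_le (z : ℝ) : normalRamp z ≤ max z 0 + normalDensity 0 := by
  have h1 := normalDensity_le_zero z
  have h2 : z * normalCDF z ≤ max z 0 := by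
    rcases le_total 0 z with hz | hz
    · exact (mul_le_of_le_one_right hz (normalCDF_le_one z)).trans (le_max_left _ _)
    · exact (mul_nonpos_of_nonpos_of_nonneg hz (normalCDF_nonneg z)).trans (le_max_right _ _)
  unfold normalRamp
  linarith

/-- The difference of the two sides is `k (-a) - k (-(2 * a))`, and `k` is chosen so that its
derivative `(2 * a + z) * normalDensity z` is nonnegative from `-(2 * a)` on. -/
lemma normalRamp_tent_lower {a : ℝ} (ha : 0 ≤ a) :
    normalDensity 0 - normalDensity a ≤
      normalRamp 0 - 2 * normalRamp (-a) + normalRamp (-(2 * a)) := by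
  let k : ℝ → ℝ := fun z => 2 * a * normalCDF z - normalDensity z
  have hk : ∀ z, HasDerivAt k ((2 * a + z) * normalDensity z) z := by
    intro z
    have h := ((hasDerivAt_normalCDF z).const_mul (2 * a)).sub (hasDerivAt_normalDensity z)
    refine h.congr_deriv ?_
    ring
  have hmono : MonotoneOn k (Set.Ici (-(2 * a))) := by
    refine monotoneOn_of_deriv_nonneg (convex_Ici _)
      (fun z _ => (hk z).continuousAt.continuousWithinAt)
      (fun z _ => (hk z).differentiableAt.differentiableWithinAt) fun z hz => ?_
    rw [interior_Ici] at hz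
    rw [(hk z).deriv]
    exact mul_nonneg (by have : -(2 * a) < z := hz; linarith) (normalDensity_nonneg z)
  have h := hmono (Set.mem_Ici.mpr le_rfl) (Set.mem_Ici.mpr (by linarith : -(2 * a) ≤ -a))
    (by linarith)
  simp only [k, normalDensity_neg] at h
  simp only [normalRamp, normalDensity_neg]
  linarith

/-! ### Heat flow of the transported tent -/

/-- The expectation of the positive part of `y + σ Z` for a standard normal variable `Z`. -/
noncomputable def scaledRamp (σ y : ℝ) : ℝ := σ * normalRamp (y / σ)

lemma hasDerivAt_scaledRamp {σ : ℝ} (hσ : 0 < σ) (y : ℝ) :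
    HasDerivAt (scaledRamp σ) (normalCDF (y / σ)) y := by
  have h := ((hasDerivAt_normalRamp (y / σ)).comp y ((hasDerivAt_id y).div_const σ)).const_mul σ
  refine h.congr_deriv ?_
  field_simp

lemma hasDerivAt_normalCDF_div (σ y : ℝ) :
    HasDerivAt (fun y => normalCDF (y / σ)) (normalDensity (y / σ) / σ) y := by
  have h := (hasDerivAt_normalCDF (y / σ)).comp y ((hasDerivAt_id y).div_const σ)
  refine h.congr_deriv ?_
  ring

/-- The `σ`-derivative is the density alone, because `normalRamp z - z * normalCDF z = normalDensity
z`. With `σ' = ε / σ` this is `ε` times the second derivative in `y`, which is the heat equation. -/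
lemma HasDerivAt.scaledRamp {σ y : ℝ → ℝ} {σ' y' s : ℝ} (hσ : HasDerivAt σ σ' s)
    (hy : HasDerivAt y y' s) (hpos : 0 < σ s) :
    HasDerivAt (fun s => scaledRamp (σ s) (y s))
      (σ' * normalDensity (y s / σ s) + y' * normalCDF (y s / σ s)) s := by
  have h := hσ.mul ((hasDerivAt_normalRamp (y s / σ s)).comp s (hy.div hσ hpos.ne'))
  refine h.congr_deriv ?_
  simp only [normalRamp, Function.comp, Pi.div_apply]
  field_simp
  ring

lemma le_scaledRamp {σ : ℝ} (hσ : 0 < σ) (y : ℝ) : max y 0 ≤ scaledRamp σ y := by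
  refine max_le ?_ (mul_nonneg hσ.le (normalRamp_nonneg _))
  have h := mul_le_mul_of_nonneg_left (self_le_normalRamp (y / σ)) hσ.le
  rwa [mul_div_cancel₀ _ hσ.ne'] at h

lemma scaledRamp_le {σ : ℝ} (hσ : 0 < σ) (y : ℝ) :
    scaledRamp σ y ≤ max y 0 + σ * normalDensity 0 := by
  have h := mul_le_mul_of_nonneg_left (normalRamp_le (y / σ)) hσ.le
  rwa [mul_add, mul_max_of_nonneg _ _ hσ.le, mul_div_cancel₀ _ hσ.ne', mul_zero] at h

/-- The standard deviation at time `s` of the heat kernel of diffusivity `ε`. -/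
noncomputable def heatScale (ε s : ℝ) : ℝ := √(2 * ε * s)

lemma heatScale_pos {ε s : ℝ} (hε : 0 < ε) (hs : 0 < s) : 0 < heatScale ε s :=
  Real.sqrt_pos.mpr (by positivity)

lemma hasDerivAt_heatScale {ε s : ℝ} (hε : 0 < ε) (hs : 0 < s) :
    HasDerivAt (heatScale ε) (ε / heatScale ε s) s := by
  have h := ((hasDerivAt_id s).const_mul (2 * ε)).sqrt (by simp [hε.ne', hs.ne'])
  have hp := heatScale_pos hε hs
  unfold heatScale at hp ⊢
  refine h.congr_deriv ?_
  simp only [id]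
  field_simp

/-- The solution of `w_t + w_x = ε w_xx` whose initial datum is the tent `max (1 - |x|) 0`. -/
noncomputable def heatTent (ε : ℝ) (z : ℝ × ℝ) : ℝ :=
  scaledRamp (heatScale ε z.2) (z.1 - z.2 + 1) - 2 * scaledRamp (heatScale ε z.2) (z.1 - z.2) +
    scaledRamp (heatScale ε z.2) (z.1 - z.2 - 1)

/-- The spatial derivative of `heatTent`. -/
noncomputable def heatTentX (ε x s : ℝ) : ℝ :=
  normalCDF ((x - s + 1) / heatScale ε s) - 2 * normalCDF ((x - s) / heatScale ε s) +
    normalCDF ((x - s - 1) / heatScale ε s)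

/-- The second spatial derivative of `heatTent`. -/
noncomputable def heatTentXX (ε x s : ℝ) : ℝ :=
  normalDensity ((x - s + 1) / heatScale ε s) / heatScale ε s -
    2 * (normalDensity ((x - s) / heatScale ε s) / heatScale ε s) +
    normalDensity ((x - s - 1) / heatScale ε s) / heatScale ε s

lemma tent_eq (y : ℝ) : max (y + 1) 0 - 2 * max y 0 + max (y - 1) 0 = max (1 - |y|) 0 := by
  grind

section heatTent

variable {ε x s : ℝ}

lemma hasDerivAt_heatTent_fst (hε : 0 < ε) (hs : 0 < s) :
    HasDerivAt (fun y => heatTent ε (y, s)) (heatTentX ε x s) x := by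
  have hd := fun y => hasDerivAt_scaledRamp (heatScale_pos hε hs) y
  have h0 := (hasDerivAt_id x).sub_const s
  have h := ((((hd _).comp x (h0.add_const 1)).sub (((hd _).comp x h0).const_mul 2))).add
    ((hd _).comp x (h0.sub_const 1))
  refine h.congr_deriv ?_
  simp [heatTentX]

lemma hasDerivAt_heatTentX :
    HasDerivAt (fun y => heatTentX ε y s) (heatTentXX ε x s) x := by
  have hd := fun y => hasDerivAt_normalCDF_div (heatScale ε s) y
  have h0 := (hasDerivAt_id x).sub_const s
  have h := ((((hd _).comp x (h0.add_const 1)).sub (((hd _).comp x h0).const_mul 2))).add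
    ((hd _).comp x (h0.sub_const 1))
  refine h.congr_deriv ?_
  simp [heatTentXX]

lemma hasDerivAt_heatTent_snd (hε : 0 < ε) (hs : 0 < s) :
    HasDerivAt (fun r => heatTent ε (x, r)) (ε * heatTentXX ε x s - heatTentX ε x s) s := by
  have hp := heatScale_pos hε hs
  have hd := hasDerivAt_heatScale hε hs
  have h0 := (hasDerivAt_id s).const_sub x
  have h := ((hd.scaledRamp (h0.add_const 1) hp).sub ((hd.scaledRamp h0 hp).const_mul 2)).add
    (hd.scaledRamp (h0.sub_const 1) hp)
  refine h.congr_deriv ?_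
  simp only [heatTentX, heatTentXX, id]
  ring

lemma contDiffOn_heatTent (hε : 0 < ε) : ContDiffOn ℝ 2 (heatTent ε) (Set.univ ×ˢ Set.Ioi 0) := by
  have hσ : ContDiffOn ℝ 2 (fun z : ℝ × ℝ => heatScale ε z.2) (Set.univ ×ˢ Set.Ioi 0) := by
    refine ContDiffOn.sqrt (by fun_prop) fun z hz => ?_
    have : 0 < z.2 := hz.2
    positivity
  have hne : ∀ z ∈ (Set.univ ×ˢ Set.Ioi 0 : Set (ℝ × ℝ)), heatScale ε z.2 ≠ 0 :=
    fun z hz => (heatScale_pos hε hz.2).ne'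
  have hr : ∀ y : ℝ × ℝ → ℝ, ContDiff ℝ 2 y → ContDiffOn ℝ 2
      (fun z => scaledRamp (heatScale ε z.2) (y z)) (Set.univ ×ˢ Set.Ioi 0) := fun y hy =>
    hσ.mul (contDiff_normalRamp.comp_contDiffOn (hy.contDiffOn.div hσ hne))
  exact ((hr _ (by fun_prop)).sub (contDiffOn_const.mul (hr _ (by fun_prop)))).add
    (hr _ (by fun_prop))

/-- The slope is a difference of two adjacent increments of `normalCDF`, which are nonnegative and
sum to at most `1`. -/
lemma abs_heatTentX_le : |heatTentX ε x s| ≤ 1 := by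
  have hp : 0 ≤ heatScale ε s := Real.sqrt_nonneg _
  have h1 : normalCDF ((x - s) / heatScale ε s) ≤ normalCDF ((x - s + 1) / heatScale ε s) :=
    normalCDF_mono (div_le_div_of_nonneg_right (by linarith) hp)
  have h2 : normalCDF ((x - s - 1) / heatScale ε s) ≤ normalCDF ((x - s) / heatScale ε s) :=
    normalCDF_mono (div_le_div_of_nonneg_right (by linarith) hp)
  have h3 := normalCDF_nonneg ((x - s - 1) / heatScale ε s)
  have h4 := normalCDF_le_one ((x - s + 1) / heatScale ε s)
  unfold heatTentX
  rw [abs_le]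
  constructor <;> linarith

lemma heatTent_le (hε : 0 < ε) (hs : 0 < s) :
    heatTent ε (x, s) ≤ max (1 - |x - s|) 0 + 2 * (heatScale ε s * normalDensity 0) := by
  have hp := heatScale_pos hε hs
  have h1 := scaledRamp_le hp (x - s + 1)
  have h2 := le_scaledRamp hp (x - s)
  have h3 := scaledRamp_le hp (x - s - 1)
  have h4 := tent_eq (x - s)
  simp only [heatTent]
  linarith

end heatTent

/-! ### The two barriers -/

/-- A viscosity solution with tent datum dominates the solution of the linear equation. -/
theorem IsViscositySolution.heatTent_le {F : ℝ → ℝ} (hF : LocallyLipschitz F)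
    (hFle : ∀ p ∈ Set.Icc (-1 : ℝ) 1, F p ≤ p) {ε : ℝ} (hε : 0 < ε) {u : ℝ × ℝ → ℝ}
    (hu : IsViscositySolution F ε (fun x => max (1 - |x|) 0) u) {x t : ℝ} (ht : 0 < t) :
    heatTent ε (x, t) ≤ u (x, t) := by
  let c : ℝ → ℝ := fun τ => τ + 2 * (heatScale ε τ * normalDensity 0)
  -- At time `0` the scale vanishes and the formula for `heatTent` degenerates to `0`, so the
  -- barrier starts at time `τ`. There it exceeds the tent by at most `c τ`: `τ` for the transport,
  -- the rest for the diffusion.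
  have key : ∀ τ, 0 < τ → heatTent ε (x, t + τ) - c τ ≤ u (x, t) := by
    intro τ hτ
    have hmaps : Set.MapsTo (fun z : ℝ × ℝ => (z.1, z.2 + τ)) (Set.univ ×ˢ Set.Ici 0)
        (Set.univ ×ˢ Set.Ioi 0) := by
      rintro ⟨y, r⟩ ⟨-, hr⟩
      exact ⟨trivial, add_pos_of_nonneg_of_pos hr hτ⟩
    have hsmooth : ContDiffOn ℝ 2 (fun z : ℝ × ℝ => heatTent ε (z.1, z.2 + τ) - c τ)
        (Set.univ ×ˢ Set.Ici 0) :=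
      ((contDiffOn_heatTent hε).comp (by fun_prop) hmaps).sub contDiffOn_const
    refine hu.supersolution.le_of_smooth_subsolution hF hε.le hu.continuousOn hu.bounded
      (v := fun z => heatTent ε (z.1, z.2 + τ) - c τ) hsmooth.continuousOn
      (hsmooth.mono (Set.prod_mono le_rfl Set.Ioi_subset_Ici_self)) ?_
      (vx := fun y r => heatTentX ε y (r + τ)) (vxx := fun y r => heatTentXX ε y (r + τ))
      (vt := fun y r => ε * heatTentXX ε y (r + τ) - heatTentX ε y (r + τ))
      (fun y r hr => ((hasDerivAt_heatTent_snd hε (by linarith)).comp_add_const r τ).sub_const _)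
      (fun y r hr => (hasDerivAt_heatTent_fst (x := y) (s := r + τ) hε (by linarith)).sub_const (c τ))
      (fun y r hr => hasDerivAt_heatTentX) (fun y r hr => abs_heatTentX_le)
      (fun y r hr => ?_) (fun y => ?_) ht
    · intro T
      refine ⟨1 + 2 * (heatScale ε (T + τ) * normalDensity 0), fun y r hr => ?_⟩
      have h1 := _root_.heatTent_le (x := y) hε (by linarith [hr.1] : 0 < r + τ)
      have h2 : heatScale ε (r + τ) ≤ heatScale ε (T + τ) := by
        unfold heatScale
        gcongr
        exact hr.2
      have h3 := mul_le_mul_of_nonneg_right h2 (normalDensity_nonneg 0)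
      have h4 : max (1 - |y - (r + τ)|) 0 ≤ 1 := max_le (by linarith [abs_nonneg (y - (r + τ))])
        zero_le_one
      have h5 : 0 ≤ c τ := add_nonneg hτ.le (mul_nonneg zero_le_two
        (mul_nonneg (Real.sqrt_nonneg _) (normalDensity_nonneg 0)))
      linarith
    · have := hFle _ (abs_le.mp (abs_heatTentX_le (ε := ε) (x := y) (s := r + τ)))
      linarith
    · have h1 := _root_.heatTent_le (x := y) hε hτ
      have h2 : max (1 - |y - τ|) 0 ≤ max (1 - |y|) 0 + τ := by
        grind
      simp only [zero_add, hu.initial, c]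
      linarith
  have hlim : Filter.Tendsto (fun τ => heatTent ε (x, t + τ) - c τ)
      (nhdsWithin 0 (Set.Ioi 0)) (nhds (heatTent ε (x, t))) := by
    have h1 : ContinuousAt (fun τ => heatTent ε (x, t + τ)) 0 :=
      ContinuousAt.comp (f := fun τ : ℝ => t + τ) (g := fun r => heatTent ε (x, r))
        (by simpa using (hasDerivAt_heatTent_snd hε ht).continuousAt) (by fun_prop)
    have h2 : ContinuousAt c 0 := by
      unfold c heatScale
      fun_prop
    simpa [c, heatScale] using (h1.tendsto.sub h2.tendsto).mono_left nhdsWithin_le_nhds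
  exact le_of_tendsto hlim (Filter.Eventually.mono self_mem_nhdsWithin key)

/-- A viscosity solution of the first-order equation with tent datum is nonpositive on the ray
`x + 1 = t`. -/
theorem IsViscositySolution.nonpos_of_add_one_eq {F : ℝ → ℝ} (hF : LocallyLipschitz F)
    (hFeq : ∀ p ∈ Set.Icc (0 : ℝ) 1, F p = p) {u : ℝ × ℝ → ℝ}
    (hu : IsViscositySolution F 0 (fun x => max (1 - |x|) 0) u) {x t : ℝ} (ht : 0 < t)
    (hxt : x + 1 = t) : u (x, t) ≤ 0 := by
  have key : ∀ η, 0 < η → u (x, t) ≤ η / 2 := by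
    intro η hη
    let S : ℝ → ℝ := fun y => √((y + 1) ^ 2 + η ^ 2)
    have hSpos : ∀ y, 0 < S y := fun y => Real.sqrt_pos.mpr (by positivity)
    have hSabs : ∀ y, |y + 1| ≤ S y := fun y => Real.abs_le_sqrt (by nlinarith)
    -- A smooth majorant of `max (y + 1) 0` with slopes in `[0, 1]`; its value at the corner `y =
    -- -1` is `η / 2`.
    let W : ℝ → ℝ := fun y => (y + 1 + S y) / 2
    have hS2 : ContDiff ℝ 2 S := ContDiff.sqrt (by fun_prop) fun y => by positivity
    have hW2 : ContDiff ℝ 2 W := ((contDiff_id.add contDiff_const).add hS2).div_const 2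
    have hW : ∀ y, HasDerivAt W ((1 + (y + 1) / S y) / 2) y := by
      intro y
      have h1 := ((((hasDerivAt_id y).add_const 1).pow 2).add_const (η ^ 2)).sqrt
        (by
          have h : 0 < (y + 1) ^ 2 + η ^ 2 := by positivity
          exact h.ne')
      have h2 := (((hasDerivAt_id y).add_const 1).add h1).div_const 2
      refine h2.congr_deriv ?_
      have := hSpos y
      simp only [S, id] at this ⊢
      norm_num
      field_simp
    have hWd : ∀ y, (1 + (y + 1) / S y) / 2 ∈ Set.Icc (0 : ℝ) 1 := by
      intro y
      have h : |(y + 1) / S y| ≤ 1 := by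
        rw [abs_div, abs_of_pos (hSpos y), div_le_one (hSpos y)]
        exact hSabs y
      have h' := abs_le.mp h
      constructor <;> linarith
    have hW' : deriv W = fun y => (1 + (y + 1) / S y) / 2 := funext fun y => (hW y).deriv
    have hWdd : ∀ y, HasDerivAt (deriv W) (deriv (deriv W) y) y := fun y =>
      ((hW2.differentiable_deriv_two) y).hasDerivAt
    have hWmem : ∀ y, deriv W y ∈ Set.Icc (0 : ℝ) 1 := fun y => by rw [hW']; exact hWd y
    have hWder : ∀ y, HasDerivAt W (deriv W y) y := fun y => by rw [hW']; exact hW y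
    have hWge : ∀ y, max (y + 1) 0 ≤ W y := fun y => by
      have h := abs_le.mp (hSabs y)
      exact max_le (by simp only [W]; linarith [le_abs_self (y + 1), hSabs y])
        (by simp only [W]; linarith)
    have hFr : LocallyLipschitz (fun p => -F (-p)) :=
      (LipschitzWith.id.neg.locallyLipschitz.comp hF).comp LipschitzWith.id.neg.locallyLipschitz
    have hsmooth : ContDiff ℝ 2 (fun z : ℝ × ℝ => -W (z.1 - z.2)) :=
      (hW2.comp (by fun_prop)).neg
    -- Bounding `u` from above is bounding `-u` from below, for the reflected Hamiltonian.
    have hcmp := hu.subsolution.neg.le_of_smooth_subsolution hFr le_rfl hu.continuousOn.neg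
      (by simpa only [abs_neg] using hu.bounded)
      (v := fun z => -W (z.1 - z.2)) hsmooth.continuous.continuousOn hsmooth.contDiffOn
      (fun T => ⟨0, fun y r _ => by
        have := (le_max_right _ _).trans (hWge (y - r))
        simp only
        linarith⟩)
      (vt := fun y r => deriv W (y - r)) (vx := fun y r => -deriv W (y - r))
      (vxx := fun y r => -deriv (deriv W) (y - r))
      (fun y r _ => by
        have h := ((hWder (y - r)).comp r ((hasDerivAt_id r).const_sub y)).neg
        exact h.congr_deriv (by ring))
      (fun y r _ => ((hWder (y - r)).comp_sub_const y r).neg)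
      (fun y r _ => ((hWdd (y - r)).comp_sub_const y r).neg)
      (fun y r _ => by
        have h := hWmem (y - r)
        rw [abs_neg, abs_of_nonneg h.1]
        exact h.2)
      (fun y r _ => by
        rw [neg_neg, hFeq _ (hWmem (y - r))]
        linarith)
      (fun y => by
        have h := hWge y
        have h' : max (1 - |y|) 0 ≤ max (y + 1) 0 := by grind
        simp only [sub_zero, hu.initial]
        linarith)
      (x₀ := x) ht
    have hval : W (x - t) = η / 2 := by
      have : x - t = -1 := by linarith
      simp [W, S, this, Real.sqrt_sq hη.le]
    simp only [hval] at hcmp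
    linarith
  refine le_of_forall_pos_le_add fun η hη => ?_
  have := key η hη
  linarith

/-! ### The value at `(0, 1)` and the conclusion -/

lemma heatTent_zero_one_lower {ε : ℝ} (hε : 0 < ε) :
    √ε / √Real.pi * (1 - Real.exp (-(1 / (4 * ε)))) ≤ heatTent ε (0, 1) := by
  have hσ := heatScale_pos hε one_pos
  set σ := heatScale ε 1 with hσdef
  have hσ2 : σ ^ 2 = 2 * ε := by
    rw [hσdef, heatScale, Real.sq_sqrt (by positivity), mul_one]
  have h := mul_le_mul_of_nonneg_left (normalRamp_tent_lower (a := 1 / σ) (by positivity)) hσ.le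
  have e : heatTent ε (0, 1) =
      σ * (normalRamp 0 - 2 * normalRamp (-(1 / σ)) + normalRamp (-(2 * (1 / σ)))) := by
    simp only [heatTent, scaledRamp, ← hσdef]
    rw [show (0 - 1 + 1 : ℝ) / σ = 0 by simp, show (0 - 1 : ℝ) / σ = -(1 / σ) by ring,
      show (0 - 1 - 1 : ℝ) / σ = -(2 * (1 / σ)) by ring]
    ring
  rw [e]
  refine le_trans (le_of_eq ?_) h
  have e1 : -(1 / σ) ^ 2 / 2 = -(1 / (4 * ε)) := by
    rw [div_pow, hσ2]
    field_simp
    norm_num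
  have e2 : σ * (√(2 * Real.pi))⁻¹ = √ε / √Real.pi := by
    rw [hσdef, heatScale, mul_one, Real.sqrt_mul zero_le_two, Real.sqrt_mul zero_le_two]
    field_simp
  rw [normalDensity_eq, normalDensity_eq, e1, ← e2]
  simp
  ring

theorem theorem1p2 (F : ℝ → ℝ) (hF : LocallyLipschitz F)
    (hF_pos : ∀ p ∈ Set.Icc (0 : ℝ) 1, F p = p)
    (hF_neg : ∀ p ∈ Set.Icc (-1 : ℝ) 0, F p ≤ p)
    (ε : ℝ) (hε : ε ∈ Set.Ioo (0 : ℝ) (1 / 4))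
    (uε u : ℝ × ℝ → ℝ)
    (huε : IsViscositySolution F ε (fun x => max (1 - |x|) 0) uε)
    (hu : IsViscositySolution F 0 (fun x => max (1 - |x|) 0) u) :
    (Real.exp 1 - 1) / (Real.sqrt Real.pi * Real.exp 1) * Real.sqrt ε
      ≤ |uε (0, 1) - u (0, 1)| := by
  have hFle : ∀ p ∈ Set.Icc (-1 : ℝ) 1, F p ≤ p := fun p hp =>
    (le_total 0 p).elim (fun h => (hF_pos p ⟨h, hp.2⟩).le) (fun h => hF_neg p ⟨hp.1, h⟩)
  have h1 := huε.heatTent_le hF hFle hε.1 (x := 0) one_pos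
  have h2 := hu.nonpos_of_add_one_eq hF hF_pos (x := 0) one_pos (zero_add 1)
  have h3 := heatTent_zero_one_lower hε.1
  -- Only here does `ε < 1 / 4` enter: it turns the factor into `1 - 1 / e`.
  have h4 : Real.exp (-(1 / (4 * ε))) ≤ Real.exp (-1) := by
    have h5 : 0 < 4 * ε := by linarith [hε.1]
    refine Real.exp_le_exp.mpr (neg_le_neg ?_)
    rw [le_div_iff₀ h5]
    linarith [hε.2]
  have h5 : (Real.exp 1 - 1) / (√Real.pi * Real.exp 1) * √ε =
      √ε / √Real.pi * (1 - Real.exp (-1)) := by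
    rw [Real.exp_neg]
    field_simp
  have h6 : √ε / √Real.pi * (1 - Real.exp (-1)) ≤
      √ε / √Real.pi * (1 - Real.exp (-(1 / (4 * ε)))) :=
    mul_le_mul_of_nonneg_left (by linarith) (by positivity)
  rw [h5]
  exact le_trans (by linarith) (le_abs_self _)
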